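/- For real $a,b,c,d,e$ and an integer $n\ge 0$ put $$J_3(a,b,c,d,e;n)=\iiint_{(0,1)^3}\frac{x^{n+b}(1-x)^{n+c}\,y^{n+e}(1-y)^{n+a}\,z^{n+a}(1-z)^{n+c}}{(1-(1-xy)z)^{n+d}}\,dx\,dy\,dz,$$ and, whenever both integrals converge and the denominator is nonzero, $$K(a,b,c,d,e)=\frac{J_3(a,b,c,d+1,e;0)}{J_3(a,b,c,d,e;0)}.$$ Then $K(0,0,0,\tfrac23,\tfrac13)$ and $K(0,0,0,\tfrac13,\tfrac23)$ are well defined (all the integrals involved converge absolutely and the denominators are nonzero), and $$K\left(0,0,0,\tfrac23,\tfrac13\right)=-\frac{K_1-2}{2(K_1-3)},\qquad\text{where } K_1=\log 3+\frac{\pi}{\sqrt3},$$ $$K\left(0,0,0,\tfrac13,\tfrac23\right)=-\frac{2(K_2+1)}{K_2+\frac12},\qquad\text{where } K_2=\log 3-\frac{\pi}{\sqrt3};$$ here $K_1\neq 3$ and $K_2\neq-\tfrac12$. -/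

import Mathlib

open Real MeasureTheory

/-- The integrand of the triple Beukers-type integral `J₃(a,b,c,d,e;n)`, at the point `(x, y, z)`.
On the open unit cube all bases of the real powers are positive. -/
noncomputable def J3Integrand (a b c d e : ℝ) (n : ℕ) (p : ℝ × ℝ × ℝ) : ℝ :=
  (p.1 ^ ((n : ℝ) + b) * (1 - p.1) ^ ((n : ℝ) + c)
      * p.2.1 ^ ((n : ℝ) + e) * (1 - p.2.1) ^ ((n : ℝ) + a)
      * p.2.2 ^ ((n : ℝ) + a) * (1 - p.2.2) ^ ((n : ℝ) + c))
    / (1 - (1 - p.1 * p.2.1) * p.2.2) ^ ((n : ℝ) + d)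

/-- The open unit cube `(0,1)³`. -/
def unitCube : Set (ℝ × ℝ × ℝ) :=
  Set.Ioo (0 : ℝ) 1 ×ˢ Set.Ioo (0 : ℝ) 1 ×ˢ Set.Ioo (0 : ℝ) 1

/-- The integral defining `J₃(a,b,c,d,e;n)` converges (absolutely). -/
def J3Converges (a b c d e : ℝ) (n : ℕ) : Prop :=
  IntegrableOn (J3Integrand a b c d e n) unitCube volume

/-- The triple integral `J₃(a,b,c,d,e;n)` over `(0,1)³`. -/
noncomputable def J3 (a b c d e : ℝ) (n : ℕ) : ℝ :=
  ∫ p in unitCube, J3Integrand a b c d e n p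

/-- `K(a,b,c,d,e) = J₃(a,b,c,d+1,e;0) / J₃(a,b,c,d,e;0)`. -/
noncomputable def quotientK (a b c d e : ℝ) : ℝ :=
  J3 a b c (d + 1) e 0 / J3 a b c d e 0

/-- The quotient `K(a,b,c,d,e)` is meaningful: both integrals converge and the
denominator is nonzero. -/
def KWellDefined (a b c d e : ℝ) : Prop :=
  J3Converges a b c (d + 1) e 0 ∧ J3Converges a b c d e 0 ∧ J3 a b c d e 0 ≠ 0

/-! With a = b = c = n = 0 the integrand is `y ^ e / (1 - (1 - x * y) * z) ^ d`. Integrating out z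
leaves a function of u = xy alone (`lintegral_Ioo_one_div_rpow`), and integrating along the curves
xy = u gives the weight (1 - u^e)/e (`lintegral_lintegral_rpow_mul_comp_mul`). For e and d in
thirds, u = t^3 turns what remains into a rational function with denominator 1 + t + t^2, whose
primitive yields log 3 and π/√3. Everything is nonnegative, so Tonelli gives convergence together
with the value, and positivity of the value excludes K₁ = 3 and K₂ = -1/2. -/

open Set

/-- The fundamental theorem of calculus for the Lebesgue integral of a nonnegative function. -/
lemma lintegral_Ioo_ofReal_eq_sub {a b : ℝ} (hab : a ≤ b) {f F : ℝ → ℝ}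
    (hF : ∀ x ∈ Icc a b, HasDerivAt F (f x) x) (hf : ContinuousOn f (Icc a b))
    (h0 : ∀ x ∈ Ioo a b, 0 ≤ f x) :
    ∫⁻ x in Ioo a b, ENNReal.ofReal (f x) = ENNReal.ofReal (F b - F a) := by
  have hint : IntegrableOn f (Ioo a b) := (hf.integrableOn_Icc).mono_set Ioo_subset_Icc_self
  rw [← ofReal_integral_eq_lintegral_ofReal hint
    ((ae_restrict_iff' measurableSet_Ioo).2 (Filter.Eventually.of_forall h0)),
    ← integral_Ioc_eq_integral_Ioo, ← intervalIntegral.integral_of_le hab]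
  congr 1
  refine intervalIntegral.integral_eq_sub_of_hasDerivAt ?_ ?_
  · rwa [uIcc_of_le hab]
  · exact ContinuousOn.intervalIntegrable (by rwa [uIcc_of_le hab])

/-! ### Changes of variables and the fibre integral over xy = u -/

lemma lintegral_Ioo_comp_mul {y : ℝ} (hy : 0 < y) (G : ℝ → ENNReal) :
    ENNReal.ofReal y * ∫⁻ x in Ioo (0 : ℝ) 1, G (x * y) = ∫⁻ u in Ioo 0 y, G u := by
  have him : (fun x : ℝ => x * y) '' Ioo 0 1 = Ioo 0 y := by
    rw [image_mul_right_Ioo _ _ hy]; simp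
  rw [← him, lintegral_image_eq_lintegral_abs_deriv_mul measurableSet_Ioo
    (fun x _ => (hasDerivAt_mul_const y).hasDerivWithinAt)
    (fun a _ b _ h => mul_right_cancel₀ hy.ne' h), lintegral_const_mul' _ _ (by simp)]
  simp [abs_of_pos hy]

lemma lintegral_Ioo_comp_cube (G : ℝ → ENNReal) :
    ∫⁻ u in Ioo (0 : ℝ) 1, G u =
      ∫⁻ t in Ioo (0 : ℝ) 1, ENNReal.ofReal (3 * t ^ 2) * G (t ^ 3) := by
  have him : (fun t : ℝ => t ^ 3) '' Ioo 0 1 = Ioo 0 1 := by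
    ext u
    constructor
    · rintro ⟨t, ⟨h0, h1⟩, rfl⟩
      exact ⟨by positivity, pow_lt_one₀ h0.le h1 (by norm_num)⟩
    · rintro ⟨h0, h1⟩
      refine ⟨u ^ (1 / 3 : ℝ), ⟨by positivity, Real.rpow_lt_one h0.le h1 (by norm_num)⟩, ?_⟩
      simp only
      rw [← Real.rpow_natCast, ← Real.rpow_mul h0.le]
      norm_num
  conv_lhs => rw [← him]
  rw [lintegral_image_eq_lintegral_abs_deriv_mul measurableSet_Ioo
    (fun x _ => (hasDerivAt_pow 3 x).hasDerivWithinAt)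
    (fun a ha b hb h => (pow_left_inj₀ ha.1.le hb.1.le (by norm_num)).1 h)]
  refine setLIntegral_congr_fun measurableSet_Ioo fun t _ => ?_
  simp only [Nat.cast_ofNat, Nat.add_one_sub_one]
  rw [abs_of_nonneg (by positivity)]

lemma lintegral_Ioo_rpow_sub_one {e u : ℝ} (he : 0 < e) (hu : u ∈ Ioo (0 : ℝ) 1) :
    ∫⁻ y in Ioo u 1, ENNReal.ofReal (y ^ (e - 1)) = ENNReal.ofReal ((1 - u ^ e) / e) := by
  have hpos : ∀ y ∈ Icc u 1, y ≠ 0 := fun y hy => (hu.1.trans_le hy.1).ne'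
  rw [lintegral_Ioo_ofReal_eq_sub (F := fun y => y ^ e / e) hu.2.le]
  · simp [sub_div]
  · intro y hy
    have := (Real.hasDerivAt_rpow_const (p := e) (Or.inl (hpos y hy))).div_const e
    rwa [mul_div_cancel_left₀ _ he.ne'] at this
  · exact fun y hy => (Real.continuousAt_rpow_const y _ (Or.inl (hpos y hy))).continuousWithinAt
  · exact fun y hy => Real.rpow_nonneg (hu.1.trans hy.1).le _

/-- Integrating out the direction along which `x * y` is constant. -/
lemma lintegral_lintegral_rpow_mul_comp_mul {e : ℝ} (he : 0 < e) {G : ℝ → ENNReal}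
    (hG : Measurable G) :
    ∫⁻ y in Ioo (0 : ℝ) 1, ∫⁻ x in Ioo (0 : ℝ) 1, ENNReal.ofReal (y ^ e) * G (x * y) =
      ∫⁻ u in Ioo (0 : ℝ) 1, ENNReal.ofReal ((1 - u ^ e) / e) * G u := by
  -- The indicator of u < y encodes the triangular domain, so the order of integration can be
  -- swapped on a square.
  let H : ℝ → ℝ → ENNReal := fun y u =>
    (Ioi u).indicator (fun y => ENNReal.ofReal (y ^ (e - 1)) * G u) y
  have hH : Measurable (Function.uncurry H) := by
    have : Function.uncurry H = {p : ℝ × ℝ | p.2 < p.1}.indicator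
        (fun p => ENNReal.ofReal (p.1 ^ (e - 1)) * G p.2) := by
      ext ⟨y, u⟩; simp [H, indicator]
    rw [this]
    refine Measurable.indicator (by fun_prop) (measurableSet_lt measurable_snd measurable_fst)
  calc _ = ∫⁻ y in Ioo (0 : ℝ) 1, ∫⁻ u in Ioo (0 : ℝ) 1, H y u := by
        refine setLIntegral_congr_fun measurableSet_Ioo fun y hy => ?_
        -- The split-off factor y is the Jacobian of u = xy at fixed y.
        have hrp : y ^ e = y ^ (e - 1) * y := by
          rw [Real.rpow_sub_one hy.1.ne', div_mul_cancel₀ _ hy.1.ne']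
        rw [lintegral_const_mul' _ _ (by simp), hrp,
          ENNReal.ofReal_mul (Real.rpow_nonneg hy.1.le _), mul_assoc,
          lintegral_Ioo_comp_mul hy.1, ← lintegral_const_mul' _ _ (by simp),
          ← lintegral_indicator measurableSet_Ioo, ← lintegral_indicator measurableSet_Ioo]
        refine lintegral_congr fun u => ?_
        have := hy.2
        simp only [indicator, H, mem_Ioo, mem_Ioi]
        grind
    _ = ∫⁻ u in Ioo (0 : ℝ) 1, ∫⁻ y in Ioo (0 : ℝ) 1, H y u :=
        lintegral_lintegral_swap hH.aemeasurable
    _ = _ := by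
        refine setLIntegral_congr_fun measurableSet_Ioo fun u hu => ?_
        simp only [H]
        rw [setLIntegral_indicator measurableSet_Ioi,
          lintegral_mul_const _ (by fun_prop), ← lintegral_Ioo_rpow_sub_one he hu]
        congr 3
        ext y
        simp only [mem_inter_iff, mem_Ioi, mem_Ioo]
        have := hu.1
        grind

/-! ### Reduction of the triple integral to one variable -/

lemma one_sub_mul_pos {u z : ℝ} (hu : 0 < u) (hz : z ∈ Icc (0 : ℝ) 1) :
    0 < 1 - (1 - u) * z := by
  rcases eq_or_lt_of_le hz.2 with rfl | h
  · linarith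
  · nlinarith [mul_nonneg hu.le hz.1]

lemma lintegral_Ioo_one_div_rpow {d u : ℝ} (hd : d ≠ 1) (hu : u ∈ Ioo (0 : ℝ) 1) :
    ∫⁻ z in Ioo (0 : ℝ) 1, ENNReal.ofReal (1 / (1 - (1 - u) * z) ^ d) =
      ENNReal.ofReal ((1 - u ^ (1 - d)) / ((1 - u) * (1 - d))) := by
  have hd' : 1 - d ≠ 0 := sub_ne_zero.2 hd.symm
  have hu' : 1 - u ≠ 0 := by linarith [hu.2]
  rw [lintegral_Ioo_ofReal_eq_sub
    (F := fun z => -((1 - (1 - u) * z) ^ (1 - d) / ((1 - u) * (1 - d)))) zero_le_one]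
  · congr 1
    simp only [mul_one, sub_sub_cancel, mul_zero, sub_zero, Real.one_rpow]
    ring
  · intro z hz
    have hp := one_sub_mul_pos hu.1 hz
    have h1 : HasDerivAt (fun z : ℝ => 1 - (1 - u) * z) (-(1 - u)) z := by
      simpa using ((hasDerivAt_id z).const_mul (1 - u)).const_sub 1
    have h2 := ((h1.rpow_const (p := 1 - d) (Or.inl hp.ne')).div_const
      ((1 - u) * (1 - d))).neg
    refine h2.congr_deriv ?_
    rw [show 1 - d - 1 = -d by ring, Real.rpow_neg hp.le]
    field_simp
  · intro z hz
    have hp := one_sub_mul_pos hu.1 hz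
    refine ContinuousAt.continuousWithinAt ?_
    refine continuousAt_const.div ?_ (Real.rpow_pos_of_pos hp _).ne'
    exact ContinuousAt.rpow_const (by fun_prop) (Or.inl hp.ne')
  · intro z hz
    exact one_div_nonneg.2 (Real.rpow_nonneg (one_sub_mul_pos hu.1 (Ioo_subset_Icc_self hz)).le _)

lemma measurable_J3Integrand (a b c d e : ℝ) (n : ℕ) : Measurable (J3Integrand a b c d e n) := by
  unfold J3Integrand
  fun_prop

lemma measurableSet_unitCube : MeasurableSet unitCube :=
  measurableSet_Ioo.prod (measurableSet_Ioo.prod measurableSet_Ioo)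

lemma J3Integrand_zero_zero_zero (d e : ℝ) (x y z : ℝ) :
    J3Integrand 0 0 0 d e 0 (x, y, z) = y ^ e * (1 / (1 - (1 - x * y) * z) ^ d) := by
  simp [J3Integrand, div_eq_mul_inv]

lemma J3Integrand_zero_zero_zero_nonneg (d e : ℝ) {p : ℝ × ℝ × ℝ} (hp : p ∈ unitCube) :
    0 ≤ J3Integrand 0 0 0 d e 0 p := by
  obtain ⟨x, y, z⟩ := p
  obtain ⟨hx, hy, hz⟩ := hp
  rw [J3Integrand_zero_zero_zero]
  exact mul_nonneg (Real.rpow_nonneg hy.1.le _) (one_div_nonneg.2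
    (Real.rpow_nonneg (one_sub_mul_pos (mul_pos hx.1 hy.1) (Ioo_subset_Icc_self hz)).le _))

lemma lintegral_J3Integrand_zero_zero_zero {d e : ℝ} (hd : d ≠ 1) (he : 0 < e) :
    ∫⁻ p in unitCube, ENNReal.ofReal (J3Integrand 0 0 0 d e 0 p) =
      ∫⁻ u in Ioo (0 : ℝ) 1, ENNReal.ofReal ((1 - u ^ e) / e) *
        ENNReal.ofReal ((1 - u ^ (1 - d)) / ((1 - u) * (1 - d))) := by
  have hm : Measurable fun p => ENNReal.ofReal (J3Integrand 0 0 0 d e 0 p) :=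
    (measurable_J3Integrand 0 0 0 d e 0).ennreal_ofReal
  rw [← lintegral_lintegral_rpow_mul_comp_mul he
    (G := fun u => ENNReal.ofReal ((1 - u ^ (1 - d)) / ((1 - u) * (1 - d)))) (by fun_prop),
    lintegral_lintegral_swap (by fun_prop), unitCube, Measure.volume_eq_prod,
    ← Measure.prod_restrict, lintegral_prod _ hm.aemeasurable]
  refine setLIntegral_congr_fun measurableSet_Ioo fun x hx => ?_
  rw [Measure.volume_eq_prod, ← Measure.prod_restrict,
    lintegral_prod (fun q => ENNReal.ofReal (J3Integrand 0 0 0 d e 0 (x, q)))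
      (hm.comp measurable_prodMk_left).aemeasurable]
  refine setLIntegral_congr_fun measurableSet_Ioo fun y hy => ?_
  simp only [J3Integrand_zero_zero_zero]
  have hxy : x * y ∈ Ioo (0 : ℝ) 1 :=
    ⟨mul_pos hx.1 hy.1, mul_lt_one_of_nonneg_of_lt_one_left hx.1.le hx.2 hy.2.le⟩
  rw [← lintegral_Ioo_one_div_rpow hd hxy, ← lintegral_const_mul' _ _ (by simp)]
  refine lintegral_congr fun z => ?_
  rw [ENNReal.ofReal_mul (Real.rpow_nonneg hy.1.le _)]

/-- If, after the substitution `u = t ^ 3`, the remaining one-dimensional integrand is `F'`,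
then the triple integral converges to `F 1 - F 0`. -/
lemma J3Converges_and_J3_eq_sub {d e : ℝ} (hd : d ≠ 1) (he : 0 < e) {f F : ℝ → ℝ}
    (hF : ∀ t ∈ Icc (0 : ℝ) 1, HasDerivAt F (f t) t) (hf : ContinuousOn f (Icc 0 1))
    (h0 : ∀ t ∈ Ioo (0 : ℝ) 1, 0 < f t)
    (hft : ∀ t ∈ Ioo (0 : ℝ) 1, f t = 3 * t ^ 2 * ((1 - t ^ (3 * e)) / e *
      ((1 - t ^ (3 * (1 - d))) / ((1 - t ^ 3) * (1 - d))))) :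
    J3Converges 0 0 0 d e 0 ∧ J3 0 0 0 d e 0 = F 1 - F 0 ∧ 0 < F 1 - F 0 := by
  have hnn : 0 ≤ᵐ[volume.restrict unitCube] J3Integrand 0 0 0 d e 0 :=
    (ae_restrict_iff' measurableSet_unitCube).2
      (Filter.Eventually.of_forall fun _ hp => J3Integrand_zero_zero_zero_nonneg d e hp)
  have hmeas := (measurable_J3Integrand 0 0 0 d e 0).aestronglyMeasurable
    (μ := volume.restrict unitCube)
  have hpos : 0 < F 1 - F 0 := by
    rw [← intervalIntegral.integral_eq_sub_of_hasDerivAt (f' := f)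
      (by rwa [uIcc_of_le zero_le_one])
      (ContinuousOn.intervalIntegrable (by rwa [uIcc_of_le zero_le_one]))]
    exact intervalIntegral.intervalIntegral_pos_of_pos_on
      (ContinuousOn.intervalIntegrable (by rwa [uIcc_of_le zero_le_one])) h0 zero_lt_one
  have hval : ∫⁻ p in unitCube, ENNReal.ofReal (J3Integrand 0 0 0 d e 0 p) =
      ENNReal.ofReal (F 1 - F 0) := by
    rw [lintegral_J3Integrand_zero_zero_zero hd he, lintegral_Ioo_comp_cube,
      ← lintegral_Ioo_ofReal_eq_sub zero_le_one hF hf fun t ht => (h0 t ht).le]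
    refine setLIntegral_congr_fun measurableSet_Ioo fun t ht => ?_
    have hcube : ∀ s : ℝ, (t ^ 3) ^ s = t ^ (3 * s) := fun s => by
      rw [Real.rpow_mul ht.1.le]; norm_cast
    have hE : 0 ≤ (1 - t ^ (3 * e)) / e :=
      div_nonneg (sub_nonneg.2 (Real.rpow_le_one ht.1.le ht.2.le (by positivity))) he.le
    simp only [hcube]
    rw [hft t ht, ENNReal.ofReal_mul (p := 3 * t ^ 2) (by positivity), ENNReal.ofReal_mul hE]
  refine ⟨⟨hmeas, ?_⟩, ?_, hpos⟩
  · rw [hasFiniteIntegral_iff_ofReal hnn, hval]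
    exact ENNReal.ofReal_lt_top
  · rw [J3, integral_eq_lintegral_of_nonneg_ae hnn hmeas, hval, ENNReal.toReal_ofReal hpos.le]

/-! ### Primitives with denominator 1 + t + t^2 -/

/-- A primitive of `(p t + q) / (1 + t + t ^ 2)`. -/
noncomputable def quadPrimitive (p q t : ℝ) : ℝ :=
  p / 2 * Real.log (1 + t + t ^ 2)
    + (2 * q - p) / Real.sqrt 3 * Real.arctan ((2 * t + 1) / Real.sqrt 3)

lemma one_add_add_sq_pos (t : ℝ) : 0 < 1 + t + t ^ 2 := by
  nlinarith [sq_nonneg (2 * t + 1)]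

lemma hasDerivAt_quadPrimitive (p q t : ℝ) :
    HasDerivAt (quadPrimitive p q) ((p * t + q) / (1 + t + t ^ 2)) t := by
  have hq := one_add_add_sq_pos t
  have h3 : Real.sqrt 3 ^ 2 = 3 := Real.sq_sqrt (by norm_num)
  have h3' : Real.sqrt 3 ≠ 0 := by positivity
  have h1 : HasDerivAt (fun t : ℝ => 1 + t + t ^ 2) (1 + 2 * t) t := by
    exact (((hasDerivAt_id' t).const_add 1).add (hasDerivAt_pow 2 t)).congr_deriv (by simp)
  have h2 : HasDerivAt (fun t : ℝ => (2 * t + 1) / Real.sqrt 3) (2 / Real.sqrt 3) t := by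
    simpa using (((hasDerivAt_id t).const_mul 2).add_const 1).div_const (Real.sqrt 3)
  refine (((h1.log hq.ne').const_mul (p / 2)).add
    (h2.arctan.const_mul ((2 * q - p) / Real.sqrt 3))).congr_deriv ?_
  have h4 : 1 + ((2 * t + 1) / Real.sqrt 3) ^ 2 = 4 / 3 * (1 + t + t ^ 2) := by
    rw [div_pow, h3]; ring
  rw [h4]
  field_simp
  rw [h3]
  ring

/-- The arctangents at the endpoints are π/3 and π/6, so they differ by π/6. -/
lemma quadPrimitive_one_sub_zero (p q : ℝ) :
    quadPrimitive p q 1 - quadPrimitive p q 0 =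
      p / 2 * Real.log 3 + (2 * q - p) / 6 * (Real.pi / Real.sqrt 3) := by
  have hb : Real.arctan (1 / Real.sqrt 3) = Real.pi / 6 := by
    rw [← Real.tan_pi_div_six]
    exact Real.arctan_tan (by linarith [Real.pi_pos]) (by linarith [Real.pi_pos])
  simp only [quadPrimitive]
  norm_num [-one_div]
  rw [hb]
  ring

/-! ### The four explicit values -/

lemma J3_two_thirds_one_third :
    J3Converges 0 0 0 (2 / 3) (1 / 3) 0 ∧
      J3 0 0 0 (2 / 3) (1 / 3) 0 = 27 / 2 * (3 - (Real.log 3 + Real.pi / Real.sqrt 3)) ∧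
      0 < 27 / 2 * (3 - (Real.log 3 + Real.pi / Real.sqrt 3)) := by
  have hV : 27 / 2 * (3 - (Real.log 3 + Real.pi / Real.sqrt 3)) =
      27 * (-(1 : ℝ) ^ 2 / 2 + 2 * 1 - quadPrimitive 1 2 1)
        - 27 * (-(0 : ℝ) ^ 2 / 2 + 2 * 0 - quadPrimitive 1 2 0) := by
    linear_combination 27 * quadPrimitive_one_sub_zero 1 2
  rw [hV]
  refine J3Converges_and_J3_eq_sub (by norm_num) (by norm_num)
    -- Polynomial division: t^2 (1 - t) / (1 + t + t^2) = 2 - t - (t + 2) / (1 + t + t^2).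
    (F := fun t => 27 * (-t ^ 2 / 2 + 2 * t - quadPrimitive 1 2 t))
    (f := fun t => 27 * (t ^ 2 * (1 - t) / (1 + t + t ^ 2))) ?_ ?_ ?_ ?_
  · intro t _
    have hq := one_add_add_sq_pos t
    refine ((((hasDerivAt_pow 2 t).neg.div_const 2).add ((hasDerivAt_id t).const_mul 2)).sub
      (hasDerivAt_quadPrimitive 1 2 t) |>.const_mul 27).congr_deriv ?_
    field_simp
    push_cast
    ring
  · exact fun t _ => ContinuousAt.continuousWithinAt (by
      have := (one_add_add_sq_pos t).ne'; fun_prop (disch := assumption))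
  · intro t ht
    have := one_add_add_sq_pos t
    have := sub_pos.2 ht.2
    have := ht.1
    positivity
  · intro t ht
    have hq := one_add_add_sq_pos t
    have h1 : 1 - t ≠ 0 := (sub_pos.2 ht.2).ne'
    norm_num
    rw [show 1 - t ^ 3 = (1 - t) * (1 + t + t ^ 2) by ring]
    field_simp
    ring

/-- Here 3(1 - d) = -2, and the Jacobian 3t^2 exactly cancels the pole at t = 0. -/
lemma J3_five_thirds_one_third :
    J3Converges 0 0 0 (2 / 3 + 1) (1 / 3) 0 ∧
      J3 0 0 0 (2 / 3 + 1) (1 / 3) 0 =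
        27 / 4 * (Real.log 3 + Real.pi / Real.sqrt 3 - 2) ∧
      0 < 27 / 4 * (Real.log 3 + Real.pi / Real.sqrt 3 - 2) := by
  have hV : 27 / 4 * (Real.log 3 + Real.pi / Real.sqrt 3 - 2) =
      27 / 2 * (quadPrimitive 1 2 1 - 1) - 27 / 2 * (quadPrimitive 1 2 0 - 0) := by
    linear_combination -27 / 2 * quadPrimitive_one_sub_zero 1 2
  rw [hV]
  refine J3Converges_and_J3_eq_sub (by norm_num) (by norm_num)
    (F := fun t => 27 / 2 * (quadPrimitive 1 2 t - t))
    (f := fun t => 27 / 2 * ((1 - t) * (1 + t) / (1 + t + t ^ 2))) ?_ ?_ ?_ ?_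
  · intro t _
    have hq := one_add_add_sq_pos t
    refine (((hasDerivAt_quadPrimitive 1 2 t).sub (hasDerivAt_id t)).const_mul
      (27 / 2)).congr_deriv ?_
    field_simp
    ring
  · exact fun t _ => ContinuousAt.continuousWithinAt (by
      have := (one_add_add_sq_pos t).ne'; fun_prop (disch := assumption))
  · intro t ht
    have := one_add_add_sq_pos t
    have := sub_pos.2 ht.2
    have := ht.1
    positivity
  · intro t ht
    have hq := one_add_add_sq_pos t
    have h1 : 1 - t ≠ 0 := (sub_pos.2 ht.2).ne'
    have h0 : t ≠ 0 := ht.1.ne'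
    norm_num
    rw [show 1 - t ^ 3 = (1 - t) * (1 + t + t ^ 2) by ring]
    field_simp
    ring

lemma J3_one_third_two_thirds :
    J3Converges 0 0 0 (1 / 3) (2 / 3) 0 ∧
      J3 0 0 0 (1 / 3) (2 / 3) 0 =
        -(27 / 8) * (Real.log 3 - Real.pi / Real.sqrt 3 + 1 / 2) ∧
      0 < -(27 / 8) * (Real.log 3 - Real.pi / Real.sqrt 3 + 1 / 2) := by
  have hV : -(27 / 8) * (Real.log 3 - Real.pi / Real.sqrt 3 + 1 / 2) =
      27 / 4 * (-(1 : ℝ) ^ 4 / 4 + 1 ^ 2 - 1 + quadPrimitive (-1) 1 1)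
        - 27 / 4 * (-(0 : ℝ) ^ 4 / 4 + 0 ^ 2 - 0 + quadPrimitive (-1) 1 0) := by
    linear_combination -27 / 4 * quadPrimitive_one_sub_zero (-1) 1
  rw [hV]
  refine J3Converges_and_J3_eq_sub (by norm_num) (by norm_num)
    (F := fun t => 27 / 4 * (-t ^ 4 / 4 + t ^ 2 - t + quadPrimitive (-1) 1 t))
    (f := fun t => 27 / 4 * (t ^ 2 * (1 - t) * (1 + t) ^ 2 / (1 + t + t ^ 2))) ?_ ?_ ?_ ?_
  · intro t _
    have hq := one_add_add_sq_pos t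
    refine (((((hasDerivAt_pow 4 t).neg.div_const 4).add (hasDerivAt_pow 2 t)).sub
      (hasDerivAt_id t)).add (hasDerivAt_quadPrimitive (-1) 1 t) |>.const_mul
      (27 / 4)).congr_deriv ?_
    field_simp
    push_cast
    ring
  · exact fun t _ => ContinuousAt.continuousWithinAt (by
      have := (one_add_add_sq_pos t).ne'; fun_prop (disch := assumption))
  · intro t ht
    have := one_add_add_sq_pos t
    have := sub_pos.2 ht.2
    have := ht.1
    positivity
  · intro t ht
    have hq := one_add_add_sq_pos t
    have h1 : 1 - t ≠ 0 := (sub_pos.2 ht.2).ne'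
    norm_num
    rw [show 1 - t ^ 3 = (1 - t) * (1 + t + t ^ 2) by ring]
    field_simp
    ring

lemma J3_four_thirds_two_thirds :
    J3Converges 0 0 0 (1 / 3 + 1) (2 / 3) 0 ∧
      J3 0 0 0 (1 / 3 + 1) (2 / 3) 0 =
        27 / 4 * (Real.log 3 - Real.pi / Real.sqrt 3 + 1) ∧
      0 < 27 / 4 * (Real.log 3 - Real.pi / Real.sqrt 3 + 1) := by
  have hV : 27 / 4 * (Real.log 3 - Real.pi / Real.sqrt 3 + 1) =
      27 / 2 * (-(1 : ℝ) ^ 2 / 2 + 1 + quadPrimitive 1 (-1) 1)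
        - 27 / 2 * (-(0 : ℝ) ^ 2 / 2 + 0 + quadPrimitive 1 (-1) 0) := by
    linear_combination -27 / 2 * quadPrimitive_one_sub_zero 1 (-1)
  rw [hV]
  refine J3Converges_and_J3_eq_sub (by norm_num) (by norm_num)
    (F := fun t => 27 / 2 * (-t ^ 2 / 2 + t + quadPrimitive 1 (-1) t))
    (f := fun t => 27 / 2 * (t * (1 - t) * (1 + t) / (1 + t + t ^ 2))) ?_ ?_ ?_ ?_
  · intro t _
    have hq := one_add_add_sq_pos t
    refine ((((hasDerivAt_pow 2 t).neg.div_const 2).add (hasDerivAt_id t)).add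
      (hasDerivAt_quadPrimitive 1 (-1) t) |>.const_mul (27 / 2)).congr_deriv ?_
    field_simp
    push_cast
    ring
  · exact fun t _ => ContinuousAt.continuousWithinAt (by
      have := (one_add_add_sq_pos t).ne'; fun_prop (disch := assumption))
  · intro t ht
    have := one_add_add_sq_pos t
    have := sub_pos.2 ht.2
    have := ht.1
    positivity
  · intro t ht
    have hq := one_add_add_sq_pos t
    have h1 : 1 - t ≠ 0 := (sub_pos.2 ht.2).ne'
    have h0 : t ≠ 0 := ht.1.ne'
    norm_num
    -- The exponent 3(1 - d) equals -1.
    rw [show 1 - t ^ 3 = (1 - t) * (1 + t + t ^ 2) by ring, Real.rpow_neg_one]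
    field_simp
    ring

theorem mainTheorem3 (K₁ K₂ : ℝ)
    (hK₁ : K₁ = Real.log 3 + Real.pi / Real.sqrt 3)
    (hK₂ : K₂ = Real.log 3 - Real.pi / Real.sqrt 3) :
    (KWellDefined 0 0 0 (2 / 3) (1 / 3) ∧ K₁ - 3 ≠ 0 ∧
      quotientK 0 0 0 (2 / 3) (1 / 3) = -((K₁ - 2) / (2 * (K₁ - 3)))) ∧
    (KWellDefined 0 0 0 (1 / 3) (2 / 3) ∧ K₂ + 1 / 2 ≠ 0 ∧
      quotientK 0 0 0 (1 / 3) (2 / 3) = -(2 * (K₂ + 1) / (K₂ + 1 / 2))) := by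
  obtain ⟨hc₁, hv₁, hp₁⟩ := J3_two_thirds_one_third
  obtain ⟨hc₂, hv₂, -⟩ := J3_five_thirds_one_third
  obtain ⟨hc₃, hv₃, hp₃⟩ := J3_one_third_two_thirds
  obtain ⟨hc₄, hv₄, -⟩ := J3_four_thirds_two_thirds
  rw [← hK₁] at hv₁ hp₁ hv₂
  rw [← hK₂] at hv₃ hp₃ hv₄
  -- Positivity of the integrals forces K₁ < 3 and K₂ < -1/2, so no numerical bounds on log 3 or π
  -- are needed.
  have h₁ : K₁ - 3 ≠ 0 := by intro h; linarith
  have h₂ : K₂ + 1 / 2 ≠ 0 := by intro h; linarith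
  refine ⟨⟨⟨hc₂, hc₁, hv₁ ▸ hp₁.ne'⟩, h₁, ?_⟩, ⟨⟨hc₄, hc₃, hv₃ ▸ hp₃.ne'⟩, h₂, ?_⟩⟩
  · rw [quotientK, hv₁, hv₂, ← neg_sub K₁ 3]
    field_simp
    norm_num
  · rw [quotientK, hv₃, hv₄]
    -- This makes the nonzero denominator an atom for `field_simp`.
    generalize K₂ + 1 / 2 = s at h₂
    field_simp
    ring
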